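/- Notation. For a family $\mathcal F\subseteq 2^{[n]}$ of non-empty subsets of $[n]=\{1,\dots,n\}$, the Kneser graph ${\rm KG}^2(\mathcal F)$ has vertex set $\mathcal F$, two members being adjacent if and only if they are disjoint. For $x\in\{-1,0,+1\}^n$ let $x^{+}$ and $x^{-}$ be the sets of positions with value $+1$ and $-1$; for a permutation $\sigma$ of $[n]$ let $alt_\sigma(x)$ be the length of a longest subsequence of non-zero terms of $(x_{\sigma(1)},\dots,x_{\sigma(n)})$ in which any two consecutive terms differ. Let $alt_{2,\sigma}(\mathcal F)$ be the largest value of $alt_\sigma(x)$ over all $x\in\{-1,0,+1\}^n\setminus\{0\}$ such that neither $x^{+}$ nor $x^{-}$ contains a member of $\mathcal F$ (and $0$ if there is no such $x$), and let $alt_2(\mathcal F)=\min_\sigma alt_{2,\sigma}(\mathcal F)$. For positive integers $p\ge 2q$, a $(p,q)$-coloring of a graph $G$ is a map $h:V(G)\to\{0,\dots,p-1\}$ with $q\le |h(x)-h(y)|\le p-q$ for every edge $xy$; the circular chromatic number is $\chi_c(G)=\inf\{p/q : G \text{ admits a } (p,q)\text{-coloring}\}$. (1) Let $\mathcal F\subseteq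 2^{[n]}$ be a non-empty family of non-empty sets such that $\chi({\rm KG}^2(\mathcal F))=n-alt_2(\mathcal F)$. If $\chi({\rm KG}^2(\mathcal F))$ is even, then $\chi_c({\rm KG}^2(\mathcal F))=\chi({\rm KG}^2(\mathcal F))$. (2) Let $k,n,m$ be positive integers, $\pi=(P_1,\dots,P_m)$ a partition of $[n]$, and $\vec s=(s_1,\dots,s_m)$ a vector of positive integers with $s_i\le |P_i|$ for all $i$ and $k\le\sum_{i=1}^m s_i$. Let ${\rm KG}^2(\pi;\vec s;k)$ be the graph whose vertices are the $k$-subsets $A$ of $[n]$ with $|A\cap P_i|\le s_i$ for all $i$, two vertices being adjacent if and only if they are disjoint. If $\chi({\rm KG}^2(\pi;\vec s;k))$ is even, then $\chi_c({\rm KG}^2(\pi;\vec s;k))=\chi({\rm KG}^2(\pi;\vec s;k))$. -/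

import Mathlib

/-- The Kneser graph `KG²(F)` of a set family `F ⊆ 2^[n]`: its vertices are the members of `F`,
and two vertices are adjacent when they are disjoint. -/
def kneserGraph {n : ℕ} (F : Finset (Finset (Fin n))) : SimpleGraph {A : Finset (Fin n) // A ∈ F} where
  Adj A B := A ≠ B ∧ Disjoint A.1 B.1
  symm := ⟨fun _ _ h => ⟨h.1.symm, h.2.symm⟩⟩
  loopless := ⟨fun _ h => h.1 rfl⟩

/-- `IsAlternating x f`: the index sequence `f 0 < f 1 < ⋯ < f (l - 1)` selects from the sign sequence
`x` a subsequence of non-zero terms in which any two consecutive terms are different. -/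
def IsAlternating {n l : ℕ} (x : Fin n → SignType) (f : Fin l → Fin n) : Prop :=
  StrictMono f ∧ (∀ i, x (f i) ≠ 0) ∧
    ∀ i j : Fin l, (i : ℕ) + 1 = (j : ℕ) → x (f i) ≠ x (f j)

/-- `alt(x)`: the length of a longest alternating subsequence of non-zero terms of `x`. -/
noncomputable def altLength {n : ℕ} (x : Fin n → SignType) : ℕ :=
  sSup {l : ℕ | ∃ f : Fin l → Fin n, IsAlternating x f}

/-- The set of positions at which the sign vector `x` takes the value `ε`; the parts of the signed
set `x` are `signPart x 1` and `signPart x (-1)`. -/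
def signPart {n : ℕ} (x : Fin n → SignType) (ε : SignType) : Finset (Fin n) :=
  Finset.univ.filter fun i => x i = ε

/-- `alt_{2,σ}(F)`: the largest `alt_σ(x)` over the non-zero sign vectors `x` neither of whose two
parts contains a member of `F`. If there is no such vector (every singleton is in `F`), it is `0`. -/
noncomputable def altPerm {n : ℕ} (F : Finset (Finset (Fin n))) (σ : Equiv.Perm (Fin n)) : ℕ :=
  sSup {l : ℕ | ∃ x : Fin n → SignType, x ≠ 0 ∧
    (∀ A ∈ F, ¬ A ⊆ signPart x 1 ∧ ¬ A ⊆ signPart x (-1)) ∧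
    altLength (fun i => x (σ i)) = l}

/-- The (first) alternation number `alt_2(F)`: the minimum of `alt_{2,σ}(F)` over all linear
orderings `σ` of the ground set. -/
noncomputable def altNumber {n : ℕ} (F : Finset (Finset (Fin n))) : ℕ :=
  ⨅ σ : Equiv.Perm (Fin n), altPerm F σ

/-- A `(p,q)`-coloring of a graph: colors in `{0, …, p - 1}` such that
`q ≤ |h x - h y| ≤ p - q` for every edge `xy`. -/
def IsCircularColoring {V : Type*} (G : SimpleGraph V) (p q : ℕ) (h : V → Fin p) : Prop :=
  ∀ x y, G.Adj x y →
    (q : ℤ) ≤ |((h x : ℕ) : ℤ) - ((h y : ℕ) : ℤ)| ∧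
      |((h x : ℕ) : ℤ) - ((h y : ℕ) : ℤ)| ≤ (p : ℤ) - (q : ℤ)

/-- The circular chromatic number: the infimum of `p / q` over all positive integers `p ≥ 2 q` for
which the graph has a `(p,q)`-coloring. -/
noncomputable def circularChromaticNumber {V : Type*} (G : SimpleGraph V) : ℝ :=
  sInf {r : ℝ | ∃ p q : ℕ, 0 < q ∧ 2 * q ≤ p ∧
    (∃ h : V → Fin p, IsCircularColoring G p q h) ∧ r = (p : ℝ) / (q : ℝ)}

/-- The vertex set of the multiple Kneser graph `KG²(π; s; k)`, `π = (P 0, …, P (m - 1))`: the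
`k`-subsets of the union of the `P i` which meet each `P i` in at most `s i` elements. The graph
itself is the Kneser graph of this family. -/
def multipleKneserFamily {n m : ℕ} (P : Fin m → Finset (Fin n)) (s : Fin m → ℕ) (k : ℕ) :
    Finset (Finset (Fin n)) :=
  Finset.univ.filter fun A =>
    A ⊆ Finset.univ.biUnion P ∧ A.card = k ∧ ∀ i, (A ∩ P i).card ≤ s i

/-! The lower bound is topological. A proper coloring of the Kneser graph gives an antipodal
labeling `kneserLabel` of the non-zero sign vectors in which comparable vectors never get opposite
labels. Fan's lemma (`IsFanLabeling.exists_alternating`) then yields `n` labels on a chain that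
alternate in sign when ordered by absolute value. At most `alt_{2,σ}(F)` of them have absolute value
at most `alt_{2,σ}(F)`; the others encode colors, and give `n - alt_{2,σ}(F)` members of `F` with
increasing colors, members at places of different parity being disjoint (`exists_zigzag`).

In a `(p,q)`-coloring, successive colors of such a sequence of `t` members grow by at least `q`. If
`t` is even, the first and last members are disjoint too, so their colors differ by at most `p - q`.
Hence `(t - 1) q ≤ p - q`, that is, `t ≤ p / q`; a proper `t`-coloring is a `(t,1)`-coloring and
attains this.

For multiple Kneser graphs it suffices to find one `σ` with `χ ≤ n - alt_{2,σ}`. If `σ` lists the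
blocks one after another, a longest alternating subsequence is balanced inside each block. Its
support `Y` is then so small that, when `Y` is not everything, an explicit coloring uses `n - |Y|`
colors.

Fan's lemma itself is a parity count: maximal chains of sign vectors are the facets of the
subdivided boundary of the cross-polytope, and induction on the dimension through hemispheres shows
that the number of facets with positively alternating labels is odd. -/

/-! ### Alternating sets of labels and their parity -/

/-- The integers in `T`, sorted by absolute value, alternate in sign, the first one having the sign
of `e`. -/
def AltSet (T : Finset ℤ) (e : ℤ) : Prop :=
  ∀ a ∈ T, 0 < e * (-1) ^ (T.filter fun b => |b| < |a|).card * a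

/-- The labels `ℓ j`, `j ∈ S`, are distinct and form an alternating set. -/
def AltLabels (ℓ : ℕ → ℤ) (S : Finset ℕ) (e : ℤ) : Prop :=
  Set.InjOn ℓ S ∧ AltSet (S.image ℓ) e

theorem AltSet.insert_max_iff {T : Finset ℤ} {m e : ℤ} (hm : ∀ a ∈ T, |a| < |m|) :
    AltSet (insert m T) e ↔ AltSet T e ∧ 0 < e * (-1) ^ T.card * m := by
  have h1 : ∀ a ∈ T, ((insert m T).filter fun b => |b| < |a|) = T.filter fun b => |b| < |a| := by
    intro a ha
    rw [Finset.filter_insert, if_neg (not_lt.2 (hm a ha).le)]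
  have h2 : ((insert m T).filter fun b => |b| < |m|) = T := by
    rw [Finset.filter_insert, if_neg (lt_irrefl _), Finset.filter_true_of_mem hm]
  unfold AltSet
  constructor
  · intro h
    refine ⟨fun a ha => ?_, ?_⟩
    · have := h a (Finset.mem_insert_of_mem ha)
      rwa [h1 a ha] at this
    · have := h m (Finset.mem_insert_self _ _)
      rwa [h2] at this
  · rintro ⟨h, h'⟩ a ha
    rcases Finset.mem_insert.1 ha with rfl | ha
    · rwa [h2]
    · rw [h1 a ha]; exact h a ha

theorem altSet_empty (e : ℤ) : AltSet ∅ e := by simp [AltSet]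

theorem sign_dichotomy {m : ℤ} (hm : m ≠ 0) (k : ℕ) :
    (0 < 1 * (-1) ^ k * m ∧ ¬ 0 < -1 * (-1) ^ k * m) ∨
    (¬ 0 < 1 * (-1) ^ k * m ∧ 0 < -1 * (-1) ^ k * m) := by
  rcases neg_one_pow_eq_or ℤ k with h | h <;> rw [h] <;> omega

open Classical in
-- Induction on the element `m` of largest absolute value. If the sign of `m` fits a positive start,
-- only erasing `m` can succeed. Otherwise the erasures of smaller elements count too; the induction
-- hypothesis evaluates them, and the two contributions of `AltSet T 1` cancel modulo 2.
theorem AltSet.card_erase_parity (T : Finset ℤ) (hT : T.Nonempty) (h0 : ∀ a ∈ T, a ≠ 0)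
    (hc : ∀ a ∈ T, ∀ b ∈ T, a ≠ -b) :
    ((T.filter fun a => AltSet (T.erase a) 1).card : ZMod 2) =
      (if AltSet T 1 then 1 else 0) + (if AltSet T (-1) then 1 else 0) := by
  induction T using Finset.induction_on_max_value (fun a : ℤ => |a|) with
  | empty => simp at hT
  | insert m T hmT hmax ih =>
    have hlt : ∀ a ∈ T, |a| < |m| := by
      intro a ha
      refine lt_of_le_of_ne (hmax a ha) fun h => ?_
      rcases abs_eq_abs.1 h with h | h
      · exact hmT (h ▸ ha)
      · exact hc a (Finset.mem_insert_of_mem ha) m (Finset.mem_insert_self _ _) h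
    have hm0 : m ≠ 0 := h0 m (Finset.mem_insert_self _ _)
    rw [AltSet.insert_max_iff hlt, AltSet.insert_max_iff hlt, Finset.filter_insert,
      Finset.erase_insert hmT]
    -- Erasing a smaller element lowers the rank of `m` by one, which reverses the sign required of
    -- `m`.
    have key : (T.filter fun a => AltSet ((insert m T).erase a) 1) =
        T.filter fun a => AltSet (T.erase a) 1 ∧ 0 < -1 * (-1) ^ T.card * m := by
      refine Finset.filter_congr fun a ha => ?_
      have ham : a ≠ m := fun h => hmT (h ▸ ha)
      rw [Finset.erase_insert_of_ne ham.symm,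
        AltSet.insert_max_iff fun b hb => hlt b (Finset.mem_of_mem_erase hb),
        Finset.card_erase_of_mem ha]
      obtain ⟨k, hk⟩ : ∃ k, T.card = k + 1 :=
        Nat.exists_eq_succ_of_ne_zero (Finset.card_ne_zero_of_mem ha)
      rw [hk, Nat.add_sub_cancel, pow_succ]
      simp
    rw [key]
    rcases T.eq_empty_or_nonempty with rfl | hne
    · rcases lt_or_gt_of_ne hm0 with h | h <;> simp [altSet_empty, h, h.le]
    · have ih := ih hne (fun a ha => h0 a (Finset.mem_insert_of_mem ha))
        fun a ha b hb => hc a (Finset.mem_insert_of_mem ha) b (Finset.mem_insert_of_mem hb)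
      have hnot : m ∉ T.filter fun a => AltSet (T.erase a) 1 := fun h =>
        hmT (Finset.mem_filter.1 h).1
      rcases sign_dichotomy hm0 T.card with ⟨h1, h2⟩ | ⟨h1, h2⟩
      · by_cases hp : AltSet T 1 <;> simp only [h1, h2, hp] <;> simp
      · simp only [h1, h2, and_true, and_false, if_false, zero_add]
        by_cases hp : AltSet T 1
        · rw [if_pos hp, Finset.card_insert_of_notMem hnot, Nat.cast_succ, ih, if_pos hp]
          rw [add_comm, ← add_assoc, show (1 + 1 : ZMod 2) = 0 from rfl, zero_add]
        · rw [if_neg hp, ih, if_neg hp, zero_add]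

open Classical in
-- Distinct labels reduce to the statement on sets. If two labels agree, only erasing one of these
-- two can restore distinctness, and both erasures leave the same set of labels, so the count is 0
-- or 2.
theorem AltLabels.card_erase_parity (ℓ : ℕ → ℤ) (S : Finset ℕ) (hS : S.Nonempty)
    (h0 : ∀ j ∈ S, ℓ j ≠ 0) (hc : ∀ i ∈ S, ∀ j ∈ S, ℓ i ≠ -ℓ j) :
    ((S.filter fun j => AltLabels ℓ (S.erase j) 1).card : ZMod 2) =
      (if AltLabels ℓ S 1 then 1 else 0) + (if AltLabels ℓ S (-1) then 1 else 0) := by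
  by_cases hinj : Set.InjOn ℓ S
  · have hT := AltSet.card_erase_parity (S.image ℓ) (hS.image ℓ)
      (by simpa using h0) (by simpa using hc)
    have hall : ∀ e, AltLabels ℓ S e ↔ AltSet (S.image ℓ) e := fun e => and_iff_right hinj
    rw [if_congr (hall _) rfl rfl, if_congr (hall _) rfl rfl, ← hT]
    congr 1
    have : (S.image ℓ).filter (fun a => AltSet ((S.image ℓ).erase a) 1) =
        (S.filter fun j => AltLabels ℓ (S.erase j) 1).image ℓ := by
      rw [Finset.filter_image]
      congr 1
      refine Finset.filter_congr fun j hj => ?_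
      have hi : Set.InjOn ℓ (S.erase j : Finset ℕ) :=
        hinj.mono (by simp)
      have : (S.image ℓ).erase (ℓ j) = (S.erase j).image ℓ := by
        ext a
        simp only [Finset.mem_erase, Finset.mem_image]
        constructor
        · rintro ⟨hne, i, hi, rfl⟩
          exact ⟨i, ⟨fun h => hne (h ▸ rfl), hi⟩, rfl⟩
        · rintro ⟨i, ⟨hne, hi⟩, rfl⟩
          exact ⟨fun h => hne (hinj hi hj h), i, hi, rfl⟩
      rw [this]; exact (and_iff_right hi).symm
    rw [this, Finset.card_image_of_injOn (hinj.mono (Finset.coe_subset.2 (Finset.filter_subset _ _)))]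
  · have hS' : ∀ e, ¬ AltLabels ℓ S e := fun e h => hinj h.1
    rw [if_neg (hS' _), if_neg (hS' _), add_zero]
    obtain ⟨i, hi, j, hj, hij, hne⟩ : ∃ i ∈ S, ∃ j ∈ S, ℓ i = ℓ j ∧ i ≠ j := by
      simpa [Set.InjOn] using hinj
    have himg : ∀ i ∈ S, ∀ j ∈ S, ℓ i = ℓ j → i ≠ j →
        (S.erase i).image ℓ = S.image ℓ := by
      intro i hi j hj hij hne
      apply Finset.Subset.antisymm (Finset.image_subset_image (Finset.erase_subset _ _))
      intro a ha
      obtain ⟨k, hk, rfl⟩ := Finset.mem_image.1 ha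
      by_cases hki : k = i
      · exact Finset.mem_image.2 ⟨j, Finset.mem_erase.2 ⟨hne.symm, hj⟩, by rw [hki, hij]⟩
      · exact Finset.mem_image.2 ⟨k, Finset.mem_erase.2 ⟨hki, hk⟩, rfl⟩
    have hiff : AltLabels ℓ (S.erase i) 1 ↔ AltLabels ℓ (S.erase j) 1 := by
      unfold AltLabels
      rw [← Finset.card_image_iff, ← Finset.card_image_iff, himg i hi j hj hij hne,
        himg j hj i hi hij.symm hne.symm, Finset.card_erase_of_mem hi, Finset.card_erase_of_mem hj]
    have hother : ∀ k, AltLabels ℓ (S.erase k) 1 → k = i ∨ k = j := by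
      intro k hk
      by_contra! hcon
      exact hne (hk.1 (by simp [hi, hcon.1.symm]) (by simp [hj, hcon.2.symm]) hij)
    by_cases hp : AltLabels ℓ (S.erase i) 1
    · have : (S.filter fun j => AltLabels ℓ (S.erase j) 1) = {i, j} := by
        ext k
        simp only [Finset.mem_filter, Finset.mem_insert, Finset.mem_singleton]
        constructor
        · exact fun h => hother k h.2
        · rintro (rfl | rfl)
          · exact ⟨hi, hp⟩
          · exact ⟨hj, hiff.1 hp⟩
      rw [this, Finset.card_pair hne]; rfl
    · have : (S.filter fun j => AltLabels ℓ (S.erase j) 1) = ∅ := by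
        refine Finset.filter_eq_empty_iff.2 fun k hk h => ?_
        rcases hother k h with rfl | rfl
        · exact hp h
        · exact hp (hiff.2 h)
      rw [this]; rfl

/-- Sorting an alternating set by absolute value. -/
theorem AltSet.exists_sorted (T : Finset ℤ) (h0 : ∀ a ∈ T, a ≠ 0)
    (hc : ∀ a ∈ T, ∀ b ∈ T, a ≠ -b) (hT : AltSet T 1) :
    ∃ b : ℕ → ℤ, (∀ i < T.card, b i ∈ T ∧ 0 < (-1) ^ i * b i) ∧
      ∀ i j, i < j → j < T.card → |b i| < |b j| := by
  induction T using Finset.induction_on_max_value (fun a : ℤ => |a|) with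
  | empty => exact ⟨fun _ => 0, by simp⟩
  | insert m T hmT hmax ih =>
    have hlt : ∀ a ∈ T, |a| < |m| := by
      intro a ha
      refine lt_of_le_of_ne (hmax a ha) fun h => ?_
      rcases abs_eq_abs.1 h with h | h
      · exact hmT (h ▸ ha)
      · exact hc a (Finset.mem_insert_of_mem ha) m (Finset.mem_insert_self _ _) h
    rw [AltSet.insert_max_iff hlt] at hT
    obtain ⟨b, hb, hmono⟩ := ih (fun a ha => h0 a (Finset.mem_insert_of_mem ha))
      (fun a ha b hb => hc a (Finset.mem_insert_of_mem ha) b (Finset.mem_insert_of_mem hb)) hT.1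
    rw [Finset.card_insert_of_notMem hmT]
    -- The largest element goes at the end of the sorted sequence.
    have hlast : Function.update b T.card m T.card = m := Function.update_self ..
    have hrest : ∀ i < T.card, Function.update b T.card m i = b i := fun i hi =>
      Function.update_of_ne hi.ne _ _
    refine ⟨Function.update b T.card m, fun i hi => ?_, fun i j hij hj => ?_⟩
    · rcases Nat.lt_succ_iff_lt_or_eq.1 hi with hi | rfl
      · rw [hrest i hi]
        exact ⟨Finset.mem_insert_of_mem (hb i hi).1, (hb i hi).2⟩
      · rw [hlast]
        exact ⟨Finset.mem_insert_self _ _, by simpa using hT.2⟩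
    · rcases Nat.lt_succ_iff_lt_or_eq.1 hj with hj | rfl
      · rw [hrest i (hij.trans hj), hrest j hj]; exact hmono i j hij hj
      · rw [hlast, hrest i hij]; exact hlt _ (hb i hij).1

theorem AltLabels.congr {ℓ ℓ' : ℕ → ℤ} {S : Finset ℕ} (h : ∀ j ∈ S, ℓ j = ℓ' j) (e : ℤ) :
    AltLabels ℓ S e ↔ AltLabels ℓ' S e := by
  unfold AltLabels
  rw [Finset.image_congr (g := ℓ') h, Set.EqOn.injOn_iff (f₂ := ℓ') h]

theorem AltSet.image_neg {T : Finset ℤ} {e : ℤ} :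
    AltSet (T.image Neg.neg) e ↔ AltSet T (-e) := by
  unfold AltSet
  rw [Finset.forall_mem_image]
  refine forall₂_congr fun a _ => ?_
  rw [Finset.filter_image, Finset.card_image_of_injective _ neg_injective]
  simp

theorem altLabels_neg {ℓ : ℕ → ℤ} {S : Finset ℕ} {e : ℤ} :
    AltLabels (fun j => -ℓ j) S e ↔ AltLabels ℓ S (-e) := by
  unfold AltLabels
  have : S.image (fun j => -ℓ j) = (S.image ℓ).image Neg.neg := by
    rw [Finset.image_image]; rfl
  rw [this, AltSet.image_neg]
  simp [Set.InjOn]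

/-! ### Chains of sign vectors and Fan's lemma -/

/-- The sign vector `y` extends the sign vector `x`. -/
def SignLE {n : ℕ} (x y : Fin n → SignType) : Prop := ∀ i, x i ≠ 0 → y i = x i

/-- An antipodal labeling of the non-zero sign vectors without complementary edges. -/
structure IsFanLabeling {n : ℕ} (L : (Fin n → SignType) → ℤ) : Prop where
  ne_zero : ∀ x, x ≠ 0 → L x ≠ 0
  map_neg : ∀ x, x ≠ 0 → L (-x) = -L x
  ne_neg : ∀ x y, x ≠ 0 → SignLE x y → L x ≠ -L y

/-- A maximal chain of sign vectors: an order in which the coordinates are added, and their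
signs. -/
abbrev SignedPerm (n : ℕ) := Equiv.Perm (Fin n) × (Fin n → Bool)

namespace SignedPerm

variable {n : ℕ}

/-- The member of rank `r` of the chain given by a signed permutation. -/
def vec (C : SignedPerm n) (r : ℕ) : Fin n → SignType := fun i =>
  if (C.1.symm i : ℕ) < r then (if C.2 i then 1 else -1) else 0

theorem signLE_vec (C : SignedPerm n) {r s : ℕ} (h : r ≤ s) : SignLE (C.vec r) (C.vec s) := by
  intro i hi
  unfold vec at *
  by_cases h1 : (C.1.symm i : ℕ) < r
  · rw [if_pos h1, if_pos (h1.trans_le h)]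
  · simp [h1] at hi

theorem vec_ne_zero (C : SignedPerm n) {r : ℕ} (hr : 0 < r) (hn : 0 < n) : C.vec r ≠ 0 := by
  intro h
  have := congrFun h (C.1 ⟨0, hn⟩)
  simp only [vec, Equiv.symm_apply_apply, hr, if_true, Pi.zero_apply] at this
  split_ifs at this

/-- The chains of sign vectors supported on the first `d` coordinates. -/
def trivialFrom (n d : ℕ) : Finset (SignedPerm n) :=
  Finset.univ.filter fun C => ∀ i : Fin n, d ≤ i → C.1 i = i ∧ C.2 i = true

/-- The labels of a chain. -/
def label (L : (Fin n → SignType) → ℤ) (C : SignedPerm n) (j : ℕ) : ℤ := L (C.vec (j + 1))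

theorem mem_trivialFrom {d : ℕ} {C : SignedPerm n} :
    C ∈ trivialFrom n d ↔ ∀ i : Fin n, d ≤ i → C.1 i = i ∧ C.2 i = true := by
  simp [trivialFrom]

/-- The chain obtained from `C` by reversing the signs on the first `d` coordinates. -/
def antipode (d : ℕ) (C : SignedPerm n) : SignedPerm n :=
  (C.1, fun i => if (i : ℕ) < d then !C.2 i else C.2 i)

theorem antipode_antipode (d : ℕ) (C : SignedPerm n) : antipode d (antipode d C) = C := by
  refine Prod.ext rfl (funext fun i => ?_)
  by_cases h : (i : ℕ) < d <;> simp [antipode, h]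

theorem antipode_mem {d : ℕ} {C : SignedPerm n} (h : C ∈ trivialFrom n d) :
    antipode d C ∈ trivialFrom n d := by
  rw [mem_trivialFrom] at *
  intro i hi
  simpa [antipode, not_lt.2 hi] using h i hi

theorem symm_val_lt {d : ℕ} {C : SignedPerm n} (h : C ∈ trivialFrom n d) {i : Fin n}
    (hi : (C.1.symm i : ℕ) < d) : (i : ℕ) < d := by
  by_contra hcon
  have := (mem_trivialFrom.1 h i (not_lt.1 hcon)).1
  rw [← this, Equiv.symm_apply_apply] at hi
  exact hcon hi

theorem vec_antipode {d r : ℕ} {C : SignedPerm n} (h : C ∈ trivialFrom n d) (hr : r ≤ d) :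
    (antipode d C).vec r = -C.vec r := by
  funext i
  simp only [vec, antipode, Pi.neg_apply]
  by_cases h1 : (C.1.symm i : ℕ) < r
  · have := symm_val_lt h (h1.trans_le hr)
    simp only [h1, this, if_true]
    cases C.2 i <;> simp
  · simp [h1]

/-- The second chain with the same members as `C` except for that of rank `j + 1`, among the chains
supported on the first `d + 1` coordinates. -/
def flip (hn : 0 < n) (d : ℕ) (C : SignedPerm n) (j : ℕ) : SignedPerm n :=
  haveI : NeZero n := ⟨hn.ne'⟩
  -- The top member changes by reversing the sign of the coordinate added last; a lower member
  -- changes by exchanging the order of two successive coordinates. The reduction modulo `n` in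
  -- `Fin.ofNat` has no effect when `j ≤ d < n`.
  if j = d then (C.1, Function.update C.2 (C.1 (Fin.ofNat n d)) (!C.2 (C.1 (Fin.ofNat n d))))
  else (C.1 * Equiv.swap (Fin.ofNat n j) (Fin.ofNat n (j + 1)), C.2)

variable {d j : ℕ}

theorem flip_flip (hn : 0 < n) (C : SignedPerm n) : flip hn d (flip hn d C j) j = C := by
  unfold flip
  by_cases h : j = d
  · simp [h]
  · simp [h, mul_assoc]

theorem flip_ne (hd : d < n) (hj : j ≤ d) (C : SignedPerm n) :
    flip (Nat.zero_lt_of_lt hd) d C j ≠ C := by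
  have : NeZero n := ⟨(Nat.zero_lt_of_lt hd).ne'⟩
  unfold flip
  by_cases h : j = d
  · intro hC
    have := congrFun (congrArg Prod.snd hC) (C.1 (Fin.ofNat n d))
    simp [h] at this
  · intro hC
    have := congrArg Prod.fst hC
    simp only [h, if_false, mul_eq_left, Equiv.swap_eq_one_iff] at this
    have := congrArg Fin.val this
    rw [Fin.val_ofNat, Fin.val_ofNat, Nat.mod_eq_of_lt (by omega), Nat.mod_eq_of_lt (by omega)]
      at this
    omega

theorem flip_mem (hd : d < n) (hj : j ≤ d) {C : SignedPerm n} (hC : C ∈ trivialFrom n (d + 1)) :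
    flip (Nat.zero_lt_of_lt hd) d C j ∈ trivialFrom n (d + 1) := by
  have : NeZero n := ⟨(Nat.zero_lt_of_lt hd).ne'⟩
  have hC' := mem_trivialFrom.1 hC
  refine mem_trivialFrom.2 fun i hi => ?_
  unfold flip
  by_cases h : j = d
  · simp only [h, if_true]
    refine ⟨(hC' i hi).1, ?_⟩
    rw [Function.update_of_ne, (hC' i hi).2]
    intro hcon
    rw [← (hC' i hi).1] at hcon
    have := congrArg Fin.val (C.1.injective hcon)
    rw [Fin.val_ofNat, Nat.mod_eq_of_lt hd] at this
    omega
  · simp only [h, if_false, Equiv.Perm.mul_apply]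
    rw [Equiv.swap_apply_of_ne_of_ne]
    · exact hC' i hi
    all_goals
      intro hcon
      have := congrArg Fin.val hcon
      rw [Fin.val_ofNat, Nat.mod_eq_of_lt (by omega)] at this
      omega

theorem vec_flip (hd : d < n) (hj : j ≤ d) (C : SignedPerm n) {r : ℕ} (hr : r ≤ d + 1)
    (hrj : r ≠ j + 1) : (flip (Nat.zero_lt_of_lt hd) d C j).vec r = C.vec r := by
  have : NeZero n := ⟨(Nat.zero_lt_of_lt hd).ne'⟩
  funext i
  unfold flip vec
  by_cases h : j = d
  · simp only [h, if_true]
    by_cases h1 : (C.1.symm i : ℕ) < r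
    · rw [Function.update_of_ne]
      rintro rfl
      rw [Equiv.symm_apply_apply, Fin.val_ofNat, Nat.mod_eq_of_lt hd] at h1
      omega
    · simp [h1]
  · simp only [h, if_false]
    have key : ∀ p : Fin n,
        ((Equiv.swap (Fin.ofNat n j) (Fin.ofNat n (j + 1)) p : Fin n) : ℕ) < r ↔ (p : ℕ) < r := by
      intro p
      have h1 : ((Fin.ofNat n j : Fin n) : ℕ) = j := by
        rw [Fin.val_ofNat, Nat.mod_eq_of_lt (by omega)]
      have h2 : ((Fin.ofNat n (j + 1) : Fin n) : ℕ) = j + 1 := by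
        rw [Fin.val_ofNat, Nat.mod_eq_of_lt (by omega)]
      rw [Equiv.swap_apply_def]
      split_ifs with ha hb
      · rw [ha, h1, h2]; omega
      · rw [hb, h1, h2]; omega
      · rfl
    have hs : (C.1 * Equiv.swap (Fin.ofNat n j) (Fin.ofNat n (j + 1))).symm i =
        Equiv.swap (Fin.ofNat n j) (Fin.ofNat n (j + 1)) (C.1.symm i) := by
      rw [Equiv.symm_apply_eq]; simp
    rw [hs]
    simp only [key]

variable {L : (Fin n → SignType) → ℤ}

theorem label_flip (hd : d < n) (hj : j ≤ d) (C : SignedPerm n) (e : ℤ) :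
    AltLabels (label L (flip (Nat.zero_lt_of_lt hd) d C j)) ((Finset.range (d + 1)).erase j) e ↔
      AltLabels (label L C) ((Finset.range (d + 1)).erase j) e := by
  refine AltLabels.congr (fun i hi => ?_) e
  rw [Finset.mem_erase, Finset.mem_range] at hi
  rw [label, label, vec_flip hd hj C (by omega) (by omega)]

theorem label_antipode (hL : IsFanLabeling L) (hn : 0 < n) {C : SignedPerm n}
    (hC : C ∈ trivialFrom n d) (e : ℤ) :
    AltLabels (label L (antipode d C)) (Finset.range d) e ↔
      AltLabels (label L C) (Finset.range d) (-e) := by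
  rw [← altLabels_neg]
  refine AltLabels.congr (fun i hi => ?_) e
  rw [Finset.mem_range] at hi
  rw [label, label, vec_antipode hC (by omega), hL.map_neg _ (vec_ne_zero C (by omega) hn)]

theorem label_ne_neg (hL : IsFanLabeling L) (hn : 0 < n) (C : SignedPerm n) (i j : ℕ) :
    label L C i ≠ -label L C j := by
  rcases le_total i j with h | h
  · exact hL.ne_neg _ _ (vec_ne_zero C (by omega) hn) (signLE_vec C (by omega))
  · have := hL.ne_neg _ _ (vec_ne_zero C (by omega) hn) (signLE_vec C (Nat.add_le_add_right h 1))
    unfold label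
    intro hcon
    exact this (by rw [hcon, neg_neg])

open Classical in
/-- The chains on the first `d` coordinates whose labels alternate, starting with a positive one. -/
noncomputable def alternating (L : (Fin n → SignType) → ℤ) (d : ℕ) : Finset (SignedPerm n) :=
  (trivialFrom n d).filter fun C => AltLabels (label L C) (Finset.range d) 1

open Classical in
/-- The chains on the first `d + 1` coordinates in the closed hemisphere where the last of these
coordinates is non-negative. -/
noncomputable def hemisphere (d : Fin n) : Finset (SignedPerm n) :=
  (trivialFrom n (d + 1)).filter fun C => C.2 d = true

open Classical in
-- The antipodal map exchanges the hemispheres and negates the labels, so positively alternating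
-- chains of the other hemisphere become negatively alternating chains of this one.
theorem card_alternating_eq_hemisphere (hL : IsFanLabeling L) (d : Fin n) :
    (alternating L (d + 1)).card =
      ((hemisphere d).filter fun C => AltLabels (label L C) (Finset.range (d + 1)) 1).card +
      ((hemisphere d).filter fun C => AltLabels (label L C) (Finset.range (d + 1)) (-1)).card := by
  have hn : 0 < n := d.pos
  rw [← Finset.card_filter_add_card_filter_not (s := alternating L (d + 1)) (fun C => C.2 d = true)]
  congr 1
  · congr 1
    ext C
    simp only [alternating, hemisphere, Finset.mem_filter]
    tauto
  · refine Finset.card_bij' (fun C _ => antipode (d + 1) C) (fun C _ => antipode (d + 1) C)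
      ?_ ?_ (fun C _ => antipode_antipode _ C) (fun C _ => antipode_antipode _ C)
    · intro C hC
      simp only [alternating, hemisphere, Finset.mem_filter] at hC ⊢
      refine ⟨⟨antipode_mem hC.1.1, ?_⟩, ?_⟩
      · simpa [antipode] using hC.2
      · rw [label_antipode hL hn hC.1.1, neg_neg]; exact hC.1.2
    · intro C hC
      simp only [alternating, hemisphere, Finset.mem_filter] at hC ⊢
      refine ⟨⟨antipode_mem hC.1.1, ?_⟩, ?_⟩
      · rw [label_antipode hL hn hC.1.1]; exact hC.2
      · simpa [antipode] using hC.1.2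

open Classical in
-- Double count, modulo 2, of the pairs of a hemisphere chain and a rank whose deletion leaves
-- positively alternating labels. Summing over chains gives the count in dimension `d + 1`. An
-- interior facet lies in exactly two chains of the hemisphere and cancels; the facets on the
-- equator are the chains on `d` coordinates.
theorem card_alternating_succ (hL : IsFanLabeling L) (d : Fin n) :
    ((alternating L (d + 1)).card : ZMod 2) = (alternating L d).card := by
  have hn : 0 < n := d.pos
  have : NeZero n := ⟨hn.ne'⟩
  have hdd : Fin.ofNat n d = d := by ext; rw [Fin.val_ofNat, Nat.mod_eq_of_lt d.2]
  set Q := (hemisphere d ×ˢ Finset.range (d + 1)).filter fun p =>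
    AltLabels (label L p.1) ((Finset.range (d + 1)).erase p.2) 1 with hQ
  have hQcard : ((alternating L (d + 1)).card : ZMod 2) = Q.card := by
    rw [card_alternating_eq_hemisphere hL, hQ, Finset.card_filter _ (hemisphere d ×ˢ _),
      Finset.sum_product, Nat.cast_add, Finset.card_filter, Finset.card_filter, Nat.cast_sum,
      Nat.cast_sum, Nat.cast_sum, ← Finset.sum_add_distrib]
    refine Finset.sum_congr rfl fun C _ => ?_
    have := AltLabels.card_erase_parity (label L C) (Finset.range (d + 1)) (by simp)
      (fun j _ => hL.ne_zero _ (vec_ne_zero C (by omega) hn))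
      (fun i _ j _ => label_ne_neg hL hn C i j)
    rw [← Finset.card_filter, this]
    simp
  -- The equatorial facets: the top member is deleted and coordinate `d` is the one added last.
  have hsplit := Finset.card_filter_add_card_filter_not (s := Q)
    (fun p => p.2 = (d : ℕ) ∧ p.1.1 d = d)
  have hmemQ : ∀ p, p ∈ Q ↔ (p.1 ∈ trivialFrom n (d + 1) ∧ p.1.2 d = true) ∧ p.2 < d + 1 ∧
      AltLabels (label L p.1) ((Finset.range (d + 1)).erase p.2) 1 := by
    intro p
    simp only [hQ, hemisphere, Finset.mem_filter, Finset.mem_product, Finset.mem_range]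
    tauto
  have hrange : (Finset.range (d + 1)).erase d = Finset.range d := by
    rw [Finset.range_add_one, Finset.erase_insert (by simp)]
  have hexc : (Q.filter fun p => p.2 = (d : ℕ) ∧ p.1.1 d = d).card = (alternating L d).card := by
    refine Finset.card_bij' (fun p _ => p.1) (fun C _ => (C, (d : ℕ))) ?_ ?_ ?_ ?_
    · intro p hp
      rw [Finset.mem_filter, hmemQ] at hp
      obtain ⟨⟨⟨h1, h2⟩, h3, h4⟩, h5, h6⟩ := hp
      rw [h5, hrange] at h4
      refine Finset.mem_filter.2 ⟨mem_trivialFrom.2 fun i hi => ?_, h4⟩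
      rcases hi.eq_or_lt with hi | hi
      · obtain rfl : d = i := Fin.ext hi
        exact ⟨h6, h2⟩
      · exact mem_trivialFrom.1 h1 i hi
    · intro C hC
      rw [alternating, Finset.mem_filter, mem_trivialFrom] at hC
      rw [Finset.mem_filter, hmemQ]
      refine ⟨⟨⟨mem_trivialFrom.2 fun i hi => hC.1 i (by omega), (hC.1 d le_rfl).2⟩, by simp, ?_⟩,
        rfl, (hC.1 d le_rfl).1⟩
      rw [hrange]; exact hC.2
    · intro p hp
      exact Prod.ext rfl (Finset.mem_filter.1 hp).2.1.symm
    · intro C hC; rfl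
  have hreg : ((Q.filter fun p => ¬ (p.2 = (d : ℕ) ∧ p.1.1 d = d)).card : ZMod 2) = 0 := by
    rw [Finset.card_eq_sum_ones, Nat.cast_sum]
    refine Finset.sum_involution (fun p _ => (flip hn d p.1 p.2, p.2)) ?_ ?_ ?_ ?_
    · intros; rfl
    · intro p hp _ hcon
      rw [Finset.mem_filter, hmemQ] at hp
      exact flip_ne d.2 (by omega) p.1 (congrArg Prod.fst hcon)
    · intro p hp
      rw [Finset.mem_filter, hmemQ] at hp ⊢
      obtain ⟨⟨⟨h1, h2⟩, h3, h4⟩, h5⟩ := hp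
      refine ⟨⟨⟨flip_mem d.2 (by omega) h1, ?_⟩, h3, (label_flip d.2 (by omega) p.1 1).2 h4⟩, ?_⟩
      -- The flip could leave the hemisphere only by reversing the sign of coordinate `d`, which is
      -- the excluded equatorial case.
      · by_cases h : p.2 = d
        · have : p.1.1 d ≠ d := fun h' => h5 ⟨h, h'⟩
          simp only [flip, h, if_true, hdd]
          rwa [Function.update_of_ne this.symm]
        · simpa [flip, h] using h2
      · rintro ⟨h, h'⟩
        have h' : (flip hn d p.1 p.2).1 d = d := h'
        have h : p.2 = (d : ℕ) := h
        simp only [flip, h, if_true] at h'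
        exact h5 ⟨h, h'⟩
    · intro p hp
      exact Prod.ext (flip_flip hn p.1) rfl
  rw [hQcard, ← hsplit, Nat.cast_add, hreg, add_zero, hexc]

theorem card_alternating (hL : IsFanLabeling L) (h : d ≤ n) :
    ((alternating L d).card : ZMod 2) = 1 := by
  induction d with
  | zero =>
    have : alternating L 0 = {(1, fun _ => true)} := by
      ext C
      simp only [alternating, Finset.mem_filter, mem_trivialFrom, Finset.mem_singleton, Prod.ext_iff,
        Equiv.ext_iff, funext_iff]
      simp [AltLabels, altSet_empty, forall_and]
    rw [this]; simp
  | succ d ih => rw [card_alternating_succ hL ⟨d, h⟩]; exact ih (by omega)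

end SignedPerm

open Classical in
/-- **Fan's lemma**: for an antipodal labeling without complementary edges some chain of sign vectors
has labels that alternate in sign when sorted by absolute value. -/
theorem IsFanLabeling.exists_alternating {n : ℕ} {L : (Fin n → SignType) → ℤ}
    (hL : IsFanLabeling L) :
    ∃ (z : Fin n → SignType) (x : ℕ → Fin n → SignType),
      (∀ i < n, x i ≠ 0 ∧ SignLE (x i) z ∧ 0 < (-1) ^ i * L (x i)) ∧
      ∀ i j, i < j → j < n → |L (x i)| < |L (x j)| := by
  have hcard := SignedPerm.card_alternating hL le_rfl
  obtain ⟨C, hC⟩ : (SignedPerm.alternating L n).Nonempty := by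
    rw [Finset.nonempty_iff_ne_empty]
    intro h
    rw [h] at hcard
    simp at hcard
  rcases Nat.eq_zero_or_pos n with rfl | hn
  · exact ⟨0, fun _ => 0, by simp⟩
  obtain ⟨hinj, halt⟩ := (Finset.mem_filter.1 hC).2
  obtain ⟨b, hb, hmono⟩ := AltSet.exists_sorted _
    (by
      simp only [Finset.forall_mem_image]
      exact fun j _ => hL.ne_zero _ (SignedPerm.vec_ne_zero C (by omega) hn))
    (by
      simp only [Finset.forall_mem_image]
      exact fun i _ j _ => SignedPerm.label_ne_neg hL hn C i j) halt
  rw [Finset.card_image_of_injOn hinj, Finset.card_range] at hb hmono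
  have : ∀ i, ∃ j, i < n → j < n ∧ SignedPerm.label L C j = b i := by
    intro i
    by_cases hi : i < n
    · obtain ⟨j, hj, h⟩ := Finset.mem_image.1 (hb i hi).1
      exact ⟨j, fun _ => ⟨Finset.mem_range.1 hj, h⟩⟩
    · exact ⟨0, fun h => absurd h hi⟩
  choose g hg using this
  have hLb : ∀ i < n, L (C.vec (g i + 1)) = b i := fun i hi => (hg i hi).2
  -- Sorting by label need not respect the order of the chain; what is kept is the common upper
  -- bound, the top of the chain.
  refine ⟨C.vec n, fun i => C.vec (g i + 1), fun i hi => ⟨C.vec_ne_zero (by omega) hn,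
    C.signLE_vec (by have := (hg i hi).1; omega), ?_⟩, fun i j hij hj => ?_⟩
  · rw [hLb i hi]; exact (hb i hi).2
  · rw [hLb i (hij.trans hj), hLb j hj]; exact hmono i j hij hj

/-! ### Longest alternating subsequences -/

section Alternation

variable {n l : ℕ} {x y : Fin n → SignType}

theorem IsAlternating.length_le {f : Fin l → Fin n} (h : IsAlternating x f) : l ≤ n := by
  simpa using Fintype.card_le_of_injective f h.1.injective

theorem bddAbove_isAlternating (x : Fin n → SignType) :
    BddAbove {l : ℕ | ∃ f : Fin l → Fin n, IsAlternating x f} :=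
  ⟨n, fun _ ⟨_, hf⟩ => hf.length_le⟩

theorem IsAlternating.le_altLength {f : Fin l → Fin n} (h : IsAlternating x f) :
    l ≤ altLength x :=
  le_csSup (bddAbove_isAlternating x) ⟨f, h⟩

theorem exists_isAlternating_altLength (x : Fin n → SignType) :
    ∃ f : Fin (altLength x) → Fin n, IsAlternating x f :=
  Nat.sSup_mem (s := {l : ℕ | ∃ f : Fin l → Fin n, IsAlternating x f})
    ⟨0, Fin.elim0, fun i => i.elim0, fun i => i.elim0, fun i => i.elim0⟩ (bddAbove_isAlternating x)

theorem altLength_le (x : Fin n → SignType) : altLength x ≤ n :=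
  (exists_isAlternating_altLength x).choose_spec.length_le

theorem altLength_pos (hx : x ≠ 0) : 0 < altLength x := by
  obtain ⟨i, hi⟩ := Function.ne_iff.1 hx
  have : IsAlternating x (fun _ : Fin 1 => i) :=
    ⟨Subsingleton.strictMono _, fun _ => hi, fun a b h => by omega⟩
  exact this.le_altLength

theorem isAlternating_neg {f : Fin l → Fin n} : IsAlternating (-x) f ↔ IsAlternating x f := by
  simp [IsAlternating, SignType.neg_eq_zero_iff]

theorem altLength_neg (x : Fin n → SignType) : altLength (-x) = altLength x := by
  simp only [altLength, isAlternating_neg]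

theorem IsAlternating.of_signLE {f : Fin l → Fin n} (h : IsAlternating x f) (hxy : SignLE x y) :
    IsAlternating y f := by
  have : ∀ i, y (f i) = x (f i) := fun i => hxy _ (h.2.1 i)
  simpa only [IsAlternating, this] using h

theorem IsAlternating.cons {g : Fin (l + 1) → Fin n} (h : IsAlternating x g) {i : Fin n}
    (hi : i < g 0) (hi0 : x i ≠ 0) (hne : x i ≠ x (g 0)) :
    IsAlternating x (Fin.cons i g : Fin (l + 2) → Fin n) := by
  refine ⟨?_, ?_, ?_⟩
  · intro a b hab
    induction a using Fin.cases with
    | zero =>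
      induction b using Fin.cases with
      | zero => exact absurd hab (lt_irrefl _)
      | succ b => exact hi.trans_le (h.1.monotone (Fin.zero_le b))
    | succ a =>
      induction b using Fin.cases with
      | zero => exact absurd hab (Fin.not_lt_zero _)
      | succ b => exact h.1 (Fin.succ_lt_succ_iff.1 hab)
  · intro a
    induction a using Fin.cases with
    | zero => exact hi0
    | succ a => exact h.2.1 a
  · intro a b hab
    induction b using Fin.cases with
    | zero => simp at hab
    | succ b =>
      induction a using Fin.cases with
      | zero =>
        obtain rfl : b = 0 := by ext; simpa using hab.symm
        exact hne
      | succ a => exact h.2.2 a b (by simpa using hab)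

/-- Some longest alternating subsequence of `x` starts with the sign `ε`. -/
def StartsWith (x : Fin n → SignType) (ε : SignType) : Prop :=
  ∃ l, altLength x = l + 1 ∧ ∃ f : Fin (l + 1) → Fin n, IsAlternating x f ∧ x (f 0) = ε

theorem startsWith_or (hx : x ≠ 0) : StartsWith x 1 ∨ StartsWith x (-1) := by
  obtain ⟨l, hl⟩ := Nat.exists_eq_succ_of_ne_zero (altLength_pos hx).ne'
  rw [Nat.succ_eq_add_one] at hl
  obtain ⟨f, hf⟩ : ∃ f : Fin (l + 1) → Fin n, IsAlternating x f :=
    hl ▸ exists_isAlternating_altLength x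
  have h0 := hf.2.1 0
  rcases h : x (f 0) with _ | _ | _
  · exact absurd h h0
  · exact Or.inr ⟨l, hl, f, hf, h⟩
  · exact Or.inl ⟨l, hl, f, hf, h⟩

/-- If two longest subsequences started with different signs, the earlier of their first terms could
be put in front of the other one, making it longer. -/
theorem StartsWith.unique {ε ε' : SignType} (h : StartsWith x ε) (h' : StartsWith x ε') :
    ε = ε' := by
  obtain ⟨l, hl, f, hf, rfl⟩ := h
  obtain ⟨l', hl', g, hg, rfl⟩ := h'
  obtain rfl : l = l' := by omega
  by_contra hne
  rcases lt_trichotomy (f 0) (g 0) with h | h | h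
  · have := (hg.cons h (hf.2.1 0) hne).le_altLength
    omega
  · exact hne (by rw [h])
  · have := (hf.cons h (hg.2.1 0) (Ne.symm hne)).le_altLength
    omega

theorem StartsWith.neg {ε : SignType} (h : StartsWith x ε) : StartsWith (-x) (-ε) := by
  obtain ⟨l, hl, f, hf, rfl⟩ := h
  exact ⟨l, by rw [altLength_neg, hl], f, isAlternating_neg.2 hf, rfl⟩

theorem StartsWith.of_signLE {ε : SignType} (h : StartsWith x ε) (hxy : SignLE x y)
    (hlen : altLength x = altLength y) : StartsWith y ε := by
  obtain ⟨l, hl, f, hf, rfl⟩ := h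
  exact ⟨l, by rw [← hlen, hl], f, hf.of_signLE hxy, hxy _ (hf.2.1 0)⟩

end Alternation

/-! ### Positive and negative parts -/

section SignPart

variable {n : ℕ} {x y : Fin n → SignType}

theorem SignLE.signPart_subset (h : SignLE x y) {ε : SignType} (hε : ε ≠ 0) :
    signPart x ε ⊆ signPart y ε := by
  intro i
  simp only [signPart, Finset.mem_filter, Finset.mem_univ, true_and]
  intro hi
  rw [h i (by rwa [hi]), hi]

theorem disjoint_signPart (x : Fin n → SignType) {ε ε' : SignType} (h : ε ≠ ε') :
    Disjoint (signPart x ε) (signPart x ε') := by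
  refine Finset.disjoint_left.2 fun i hi hi' => h ?_
  rw [← (Finset.mem_filter.1 hi).2, (Finset.mem_filter.1 hi').2]

theorem signPart_neg (x : Fin n → SignType) (ε : SignType) :
    signPart (-x) ε = signPart x (-ε) := by
  ext i
  simp only [signPart, Finset.mem_filter, Finset.mem_univ, true_and, Pi.neg_apply]
  exact neg_eq_iff_eq_neg

theorem exists_subset_signPart {F : Finset (Finset (Fin n))} {σ : Equiv.Perm (Fin n)} (hx : x ≠ 0)
    (h : altPerm F σ < altLength fun i => x (σ i)) :
    ∃ A ∈ F, A ⊆ signPart x 1 ∨ A ⊆ signPart x (-1) := by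
  by_contra! hcon
  refine not_le.2 h (le_csSup ⟨n, ?_⟩ ⟨x, hx, hcon, rfl⟩)
  rintro _ ⟨x, -, -, rfl⟩
  exact altLength_le _

end SignPart

/-! ### The Fan labeling of a coloring and the zig-zag theorem -/

section Labeling

variable {n : ℕ} (F : Finset (Finset (Fin n))) (c : Finset (Fin n) → ℕ) (σ : Equiv.Perm (Fin n))

/-- One more than the largest color of a member of `F` contained in `X`, or `0` if there is none. -/
def maxColor (X : Finset (Fin n)) : ℕ := (F.filter fun A => A ⊆ X).sup fun A => c A + 1

variable {F c}

theorem maxColor_pos {X A : Finset (Fin n)} (hA : A ∈ F) (h : A ⊆ X) : 0 < maxColor F c X :=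
  (Nat.succ_pos (c A)).trans_le
    (Finset.le_sup (f := fun A => c A + 1) (Finset.mem_filter.2 ⟨hA, h⟩))

theorem exists_maxColor {X : Finset (Fin n)} (h : 0 < maxColor F c X) :
    ∃ A ∈ F, A ⊆ X ∧ c A + 1 = maxColor F c X := by
  have hne : (F.filter fun A => A ⊆ X).Nonempty := by
    rw [Finset.nonempty_iff_ne_empty]
    intro h0
    simp [maxColor, h0] at h
  obtain ⟨A, hA, h⟩ := Finset.exists_mem_eq_sup _ hne fun A => c A + 1
  rw [Finset.mem_filter] at hA
  exact ⟨A, hA.1, hA.2, h.symm⟩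

theorem maxColor_ne (hc : ∀ A ∈ F, ∀ B ∈ F, Disjoint A B → c A ≠ c B) {X Y : Finset (Fin n)}
    (hXY : Disjoint X Y) (hX : 0 < maxColor F c X) : maxColor F c X ≠ maxColor F c Y := by
  intro h
  obtain ⟨A, hA, hAX, h1⟩ := exists_maxColor hX
  obtain ⟨B, hB, hBY, h2⟩ := exists_maxColor (h ▸ hX)
  exact hc A hA B hB (Finset.disjoint_of_subset_left hAX (Finset.disjoint_of_subset_right hBY hXY))
    (by omega)

variable (F c)

open Classical in
/-- The labeling of the sign vectors obtained from a coloring of the Kneser graph of `F`. -/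
noncomputable def kneserLabel (x : Fin n → SignType) : ℤ :=
  -- Two ranges of absolute values: up to `altPerm F σ` the label records the alternation length,
  -- above it the largest color found in a part.
  if altLength (fun i => x (σ i)) ≤ altPerm F σ then
    if StartsWith (fun i => x (σ i)) 1 then altLength (fun i => x (σ i))
    else -altLength (fun i => x (σ i))
  else
    if maxColor F c (signPart x (-1)) < maxColor F c (signPart x 1) then
      altPerm F σ + maxColor F c (signPart x 1)
    else -(altPerm F σ + maxColor F c (signPart x (-1)))

variable {F c σ} {x y : Fin n → SignType}

theorem comp_perm_ne_zero (hx : x ≠ 0) : (fun i => x (σ i)) ≠ 0 := by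
  intro h
  refine hx (funext fun i => ?_)
  simpa using congrFun h (σ.symm i)

theorem neg_vec_ne_zero (hx : x ≠ 0) : -x ≠ 0 := by
  intro h
  refine hx (funext fun i => ?_)
  simpa using congrFun h i

theorem kneserLabel_of_le (hx : x ≠ 0) (h : altLength (fun i => x (σ i)) ≤ altPerm F σ) :
    kneserLabel F c σ x = altLength (fun i => x (σ i)) ∧ StartsWith (fun i => x (σ i)) 1 ∨
    kneserLabel F c σ x = -altLength (fun i => x (σ i)) ∧ StartsWith (fun i => x (σ i)) (-1) := by
  unfold kneserLabel
  rw [if_pos h]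
  by_cases h1 : StartsWith (fun i => x (σ i)) 1
  · exact Or.inl ⟨if_pos h1, h1⟩
  · exact Or.inr ⟨if_neg h1, (startsWith_or (comp_perm_ne_zero hx)).resolve_left h1⟩

theorem kneserLabel_of_lt (hx : x ≠ 0)
    (h : altPerm F σ < altLength (fun i => x (σ i))) :
    kneserLabel F c σ x = altPerm F σ + maxColor F c (signPart x 1) ∧
        maxColor F c (signPart x (-1)) < maxColor F c (signPart x 1) ∨
      kneserLabel F c σ x = -(altPerm F σ + maxColor F c (signPart x (-1))) ∧
        maxColor F c (signPart x 1) ≤ maxColor F c (signPart x (-1)) ∧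
        0 < maxColor F c (signPart x (-1)) := by
  unfold kneserLabel
  rw [if_neg (not_le.2 h)]
  by_cases h1 : maxColor F c (signPart x (-1)) < maxColor F c (signPart x 1)
  · exact Or.inl ⟨if_pos h1, h1⟩
  · refine Or.inr ⟨if_neg h1, not_lt.1 h1, ?_⟩
    obtain ⟨A, hA, hA1 | hA1⟩ := exists_subset_signPart hx h
    · exact (maxColor_pos hA hA1).trans_le (not_lt.1 h1)
    · exact maxColor_pos hA hA1

/-- Let `x ≤ y` have labels of equal absolute value. In the low range the alternation lengths agree,
so a longest subsequence of `x` is one of `y` and fixes the same initial sign. In the high range,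
opposite labels would put one color on members inside opposite parts of `x` and `y`, which are
disjoint. -/
theorem isFanLabeling_kneserLabel (hc : ∀ A ∈ F, ∀ B ∈ F, Disjoint A B → c A ≠ c B) :
    IsFanLabeling (kneserLabel F c σ) := by
  have hneg : ∀ x : Fin n → SignType, altLength (fun i => (-x) (σ i)) =
      altLength fun i => x (σ i) := fun x => altLength_neg fun i => x (σ i)
  have h1 : (1 : SignType) ≠ -1 := by decide
  constructor
  · intro x hx
    have hpos := altLength_pos (comp_perm_ne_zero (σ := σ) hx)
    rcases le_or_gt (altLength fun i => x (σ i)) (altPerm F σ) with h | h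
    · rcases kneserLabel_of_le (c := c) hx h with h | h <;> omega
    · rcases kneserLabel_of_lt (c := c) hx h with h | h <;> omega
  · intro x hx
    rcases le_or_gt (altLength fun i => x (σ i)) (altPerm F σ) with h | h
    · have h' : altLength (fun i => (-x) (σ i)) ≤ altPerm F σ := by rwa [hneg]
      have hu := kneserLabel_of_le (c := c) hx h
      have hv := kneserLabel_of_le (c := c) (neg_vec_ne_zero hx) h'
      rw [hneg] at hv
      rcases hu with ⟨hu, hu'⟩ | ⟨hu, hu'⟩ <;> rcases hv with ⟨hv, hv'⟩ | ⟨hv, hv'⟩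
      · exact absurd (hv'.unique hu'.neg) h1
      · rw [hu, hv]
      · rw [hu, hv, neg_neg]
      · exact absurd (hv'.unique hu'.neg) (by decide)
    · have h' : altPerm F σ < altLength (fun i => (-x) (σ i)) := by rwa [hneg]
      have hu := kneserLabel_of_lt (c := c) hx h
      have hv := kneserLabel_of_lt (c := c) (neg_vec_ne_zero hx) h'
      rw [signPart_neg, signPart_neg, neg_neg] at hv
      have := maxColor_ne hc (disjoint_signPart x h1.symm)
      rcases hu with ⟨hu, hu'⟩ | ⟨hu, hu', hu''⟩ <;> rcases hv with ⟨hv, hv'⟩ | ⟨hv, hv', hv''⟩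
      all_goals omega
  · intro x y hx hxy
    have hy : y ≠ 0 := by
      rintro rfl
      refine hx (funext fun i => ?_)
      by_contra hi
      exact hi (hxy i hi).symm
    have hxy' : SignLE (fun i => x (σ i)) (fun i => y (σ i)) := fun i hi => hxy _ hi
    rcases le_or_gt (altLength fun i => x (σ i)) (altPerm F σ) with h | h <;>
      rcases le_or_gt (altLength fun i => y (σ i)) (altPerm F σ) with h' | h'
    · have hpos := altLength_pos (comp_perm_ne_zero (σ := σ) hx)
      rcases kneserLabel_of_le (c := c) hx h with ⟨hu, hu'⟩ | ⟨hu, hu'⟩ <;>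
      rcases kneserLabel_of_le (c := c) hy h' with ⟨hv, hv'⟩ | ⟨hv, hv'⟩ <;> intro hcon
      · omega
      · exact absurd (hv'.unique (hu'.of_signLE hxy' (by omega))) (by decide)
      · exact absurd (hv'.unique (hu'.of_signLE hxy' (by omega))) h1
      · omega
    · rcases kneserLabel_of_le (c := c) hx h with hu | hu <;>
      rcases kneserLabel_of_lt (c := c) hy h' with hv | hv <;> omega
    · rcases kneserLabel_of_lt (c := c) hx h with hu | hu <;>
      rcases kneserLabel_of_le (c := c) hy h' with hv | hv <;> omega
    · rcases kneserLabel_of_lt (c := c) hx h with ⟨hu, hu'⟩ | ⟨hu, -, hu'⟩ <;>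
      rcases kneserLabel_of_lt (c := c) hy h' with ⟨hv, hv'⟩ | ⟨hv, -, hv'⟩ <;> intro hcon
      · omega
      · refine maxColor_ne hc (Finset.disjoint_of_subset_left
          (hxy.signPart_subset one_ne_zero) (disjoint_signPart y h1)) ?_ ?_ <;> omega
      · refine maxColor_ne hc (Finset.disjoint_of_subset_left
          (hxy.signPart_subset (by decide)) (disjoint_signPart y h1.symm)) hu' ?_
        omega
      · omega

/-- **Zig-zag theorem**: in a proper coloring of the Kneser graph of `F` some
`n - alt_{2,σ}(F)` members with increasing colors alternate between the two sides of a complete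
bipartite subgraph. -/
theorem exists_zigzag (hc : ∀ A ∈ F, ∀ B ∈ F, Disjoint A B → c A ≠ c B) {t : ℕ}
    (ht : t + altPerm F σ ≤ n) :
    ∃ A : ℕ → Finset (Fin n), (∀ i < t, A i ∈ F) ∧
      (∀ i j, i < j → j < t → c (A i) < c (A j)) ∧
      ∀ i j, i < t → j < t → Odd (i + j) → Disjoint (A i) (A j) := by
  set a := altPerm F σ with ha
  obtain ⟨z, x, hx, hmono⟩ := (isFanLabeling_kneserLabel (σ := σ) hc).exists_alternating
  set L := kneserLabel F c σ with hL
  -- Positive, strictly increasing integers: from index `a` on, the labels exceed `a` and so encode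
  -- colors.
  have hbig : ∀ i < n, (i : ℤ) + 1 ≤ |L (x i)| := by
    intro i
    induction i with
    | zero =>
      intro h
      have : 0 < |L (x 0)| := abs_pos.2 ((isFanLabeling_kneserLabel (σ := σ) hc).ne_zero _ (hx 0 h).1)
      push_cast; omega
    | succ i ih =>
      intro h
      have h1 := ih (by omega)
      have h2 := hmono i (i + 1) (by omega) h
      push_cast; omega
  have key : ∀ i, ∃ A, i < t → A ∈ F ∧ (c A : ℤ) + 1 + a = |L (x (a + i))| ∧
      A ⊆ signPart z (if Even (a + i) then 1 else -1) := by
    intro i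
    by_cases hi : i < t
    swap
    · exact ⟨∅, fun h => absurd h hi⟩
    have hin : a + i < n := by omega
    obtain ⟨h0, hle, hsgn⟩ := hx _ hin
    have hb := hbig _ hin
    have hlt : altPerm F σ < altLength fun j => x (a + i) (σ j) := by
      by_contra! hcon
      rcases kneserLabel_of_le (c := c) h0 hcon with ⟨h, -⟩ | ⟨h, -⟩ <;>
        simp only [hL, h, abs_neg, Nat.abs_cast] at hb <;> omega
    rcases kneserLabel_of_lt (c := c) h0 hlt with ⟨h, h'⟩ | ⟨h, -, h'⟩
    · obtain ⟨A, hA, hAs, hAc⟩ := exists_maxColor (h'.trans_le' (Nat.zero_le _))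
      refine ⟨A, fun _ => ⟨hA, ?_, ?_⟩⟩
      · rw [hL, h, ← hAc, abs_of_nonneg (by omega)]; push_cast; ring
      · have : Even (a + i) := by
          by_contra hodd
          rw [(Nat.not_even_iff_odd.1 hodd).neg_one_pow, hL, h] at hsgn
          omega
        rw [if_pos this]
        exact hAs.trans (hle.signPart_subset one_ne_zero)
    · obtain ⟨A, hA, hAs, hAc⟩ := exists_maxColor h'
      refine ⟨A, fun _ => ⟨hA, ?_, ?_⟩⟩
      · rw [hL, h, ← hAc, abs_neg, abs_of_nonneg (by omega)]; push_cast; ring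
      · have : ¬ Even (a + i) := by
          intro heven
          rw [heven.neg_one_pow, hL, h] at hsgn
          omega
        rw [if_neg this]
        exact hAs.trans (hle.signPart_subset (by decide))
  choose A hA using key
  refine ⟨A, fun i hi => (hA i hi).1, fun i j hij hj => ?_, fun i j hi hj hodd => ?_⟩
  · have h1 := (hA i (hij.trans hj)).2.1
    have h2 := (hA j hj).2.1
    have := hmono (a + i) (a + j) (by omega) (by omega)
    omega
  · refine Finset.disjoint_of_subset_left (hA i hi).2.2
      (Finset.disjoint_of_subset_right (hA j hj).2.2 (disjoint_signPart z ?_))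
    -- Indices of different parity carry labels of opposite signs, hence members in opposite parts
    -- of `z`.
    rw [Nat.odd_add] at hodd
    by_cases h1 : Even (a + i) <;> by_cases h2 : Even (a + j)
    · exfalso; simp only [Nat.even_add, ← Nat.not_even_iff_odd] at *; tauto
    · simp only [h1, h2]; decide
    · simp only [h1, h2]; decide
    · exfalso; simp only [Nat.even_add, ← Nat.not_even_iff_odd] at *; tauto

end Labeling

/-! ### Circular colorings of Kneser graphs -/

section Circular

variable {n : ℕ} {F : Finset (Finset (Fin n))}

/-- Along the zig-zag sequence each step raises the color by at least `q`, and evenness of `t` makes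
the two ends disjoint, so the total rise is at most `p - q`. -/
theorem mul_le_of_isCircularColoring (hF : ∅ ∉ F) {σ : Equiv.Perm (Fin n)} {t p q : ℕ}
    (ht : t + altPerm F σ ≤ n) (heven : Even t) (hq : 0 < q) {h : {A // A ∈ F} → Fin p}
    (hh : IsCircularColoring (kneserGraph F) p q h) : t * q ≤ p := by
  rcases Nat.eq_zero_or_pos t with rfl | htpos
  · simp
  classical
  set c : Finset (Fin n) → ℕ := fun A => if hA : A ∈ F then h ⟨A, hA⟩ else 0 with hcdef
  have hcF : ∀ A (hA : A ∈ F), c A = h ⟨A, hA⟩ := fun A hA => dif_pos hA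
  have hadj : ∀ A ∈ F, ∀ B ∈ F, Disjoint A B →
      (q : ℤ) ≤ |(c A : ℤ) - c B| ∧ |(c A : ℤ) - c B| ≤ (p : ℤ) - q := by
    intro A hA B hB hAB
    rw [hcF A hA, hcF B hB]
    refine hh ⟨A, hA⟩ ⟨B, hB⟩ ⟨fun hcon => ?_, hAB⟩
    obtain rfl : A = B := congrArg Subtype.val hcon
    obtain rfl : A = ∅ := disjoint_self.1 hAB
    exact hF hA
  have hc : ∀ A ∈ F, ∀ B ∈ F, Disjoint A B → c A ≠ c B := by
    intro A hA B hB hAB heq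
    have := (hadj A hA B hB hAB).1
    rw [heq, sub_self, abs_zero] at this
    omega
  obtain ⟨A, hA, hmono, hdisj⟩ := exists_zigzag hc ht
  have hstep : ∀ i < t, c (A 0) + i * q ≤ c (A i) := by
    intro i
    induction i with
    | zero => simp
    | succ i ih =>
      intro hi
      have h1 := ih (by omega)
      have h2 := hmono i (i + 1) (by omega) hi
      have h3 := (hadj _ (hA (i + 1) hi) _ (hA i (by omega))
        (hdisj (i + 1) i hi (by omega) ⟨i, by ring⟩)).1
      rw [abs_of_nonneg (by omega)] at h3
      rw [add_mul]
      omega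
  obtain ⟨s, rfl⟩ : ∃ s, t = s + 1 := ⟨t - 1, by omega⟩
  have hodd : Odd (s + 0) := by
    rw [add_zero, ← Nat.not_even_iff_odd]
    exact fun hs => Nat.even_add_one.1 heven hs
  have h1 := hstep s (by omega)
  have h2 := (hadj _ (hA s (by omega)) _ (hA 0 htpos) (hdisj s 0 (by omega) htpos hodd)).2
  rw [abs_of_nonneg (by omega)] at h2
  rw [add_mul]
  omega

theorem isCircularColoring_of_coloring {V : Type*} {G : SimpleGraph V} {t : ℕ}
    (h : G.Coloring (Fin t)) : IsCircularColoring G t 1 h := by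
  intro x y hxy
  have hne : ((h x : ℕ) : ℤ) ≠ ((h y : ℕ) : ℤ) := fun hcon =>
    h.valid hxy (Fin.ext (by exact_mod_cast hcon))
  have h1 := (h x).2
  have h2 := (h y).2
  constructor
  · have := abs_pos.2 (sub_ne_zero.2 hne)
    omega
  · rw [abs_le]; omega

/-- For an even number `t` of colors, a `t`-coloring of a Kneser graph with
`t ≤ n - alt_{2,σ}(F)` is optimal among the circular colorings. -/
theorem circularChromaticNumber_kneserGraph (hne : F.Nonempty) (hF : ∅ ∉ F)
    {σ : Equiv.Perm (Fin n)} {t : ℕ} (hcol : (kneserGraph F).Colorable t)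
    (ht : t + altPerm F σ ≤ n) (heven : Even t) :
    circularChromaticNumber (kneserGraph F) = t := by
  obtain ⟨h⟩ := hcol
  -- The pair `(t, 1)` is admissible only if `t ≥ 2`: a vertex exists, so `t > 0`, and `t` is even.
  have ht2 : 2 ≤ t := by
    obtain ⟨A, hA⟩ := hne
    have := (h ⟨A, hA⟩).2
    obtain ⟨s, rfl⟩ := heven
    omega
  refine IsLeast.csInf_eq ⟨⟨t, 1, one_pos, by omega, ⟨h, isCircularColoring_of_coloring h⟩,
    by simp⟩, ?_⟩
  rintro _ ⟨p, q, hq, -, ⟨h, hh⟩, rfl⟩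
  rw [le_div_iff₀ (by exact_mod_cast hq)]
  exact_mod_cast mul_le_of_isCircularColoring hF ht heven hq hh

end Circular

theorem exists_altPerm_eq_altNumber {n : ℕ} (F : Finset (Finset (Fin n))) :
    ∃ σ : Equiv.Perm (Fin n), altPerm F σ = altNumber F :=
  Nat.sInf_mem (Set.range_nonempty fun σ => altPerm F σ)

/-! ### Multiple Kneser graphs -/

/-- In an interval of an alternating sign sequence each sign occurs at most once more often than the
other one. -/
theorem card_filter_le_of_alternating {l : ℕ} {ε : Fin l → SignType} (h0 : ∀ i, ε i ≠ 0)
    (hne : ∀ i j : Fin l, (i : ℕ) + 1 = j → ε i ≠ ε j) {J : Finset (Fin l)}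
    (hJ : (J : Set (Fin l)).OrdConnected) (e : SignType) :
    (J.filter fun j => ε j = e).card ≤ (J.filter fun j => ε j = -e).card + 1 := by
  rcases J.eq_empty_or_nonempty with rfl | hJne
  · simp
  rw [← Nat.sub_le_iff_le_add]
  -- Apart from the last index of `J`, each occurrence of `e` is followed within `J` by an
  -- occurrence of `-e`; the successor map is injective. Its value at an index without a successor
  -- is never used.
  refine (Finset.pred_card_le_card_erase (a := J.max' hJne)).trans ?_
  refine Finset.card_le_card_of_injOn
    (fun j => if h : (j : ℕ) + 1 < l then ⟨j + 1, h⟩ else j) ?_ ?_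
  all_goals
    have hlt : ∀ j ∈ ((J.filter fun j => ε j = e).erase (J.max' hJne) : Finset (Fin l)),
        (j : ℕ) + 1 ≤ (J.max' hJne : Fin l) := by
      intro j hj
      rw [Finset.mem_erase, Finset.mem_filter] at hj
      exact Fin.lt_def.1 (lt_of_le_of_ne (J.le_max' j hj.2.1) hj.1)
  · intro j hj
    have hj1 := hlt j hj
    have hjl : (j : ℕ) + 1 < l := hj1.trans_lt (J.max' hJne).2
    rw [Finset.mem_coe, Finset.mem_erase, Finset.mem_filter] at hj
    simp only [hjl, dif_pos]
    rw [Finset.mem_coe, Finset.mem_filter]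
    refine ⟨hJ.out hj.2.1 (J.max'_mem hJne) ⟨Fin.le_def.2 (Nat.le_succ _), Fin.le_def.2 hj1⟩, ?_⟩
    have h1 := hne j ⟨j + 1, hjl⟩ rfl
    have h2 := h0 j
    have h3 := h0 ⟨j + 1, hjl⟩
    rw [← hj.2.2]
    revert h1 h2 h3
    generalize ε j = u
    generalize ε ⟨j + 1, hjl⟩ = v
    revert u v
    decide
  · intro i hi j hj hij
    have hi1 : (i : ℕ) + 1 < l := (hlt i hi).trans_lt (J.max' hJne).2
    have hj1 : (j : ℕ) + 1 < l := (hlt j hj).trans_lt (J.max' hJne).2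
    simp only [hi1, hj1, dif_pos, Fin.mk.injEq, Nat.add_right_cancel_iff] at hij
    exact Fin.ext hij

section MultipleKneser

variable {n m k : ℕ} {P : Fin m → Finset (Fin n)} {s : Fin m → ℕ}

theorem mem_multipleKneserFamily {A : Finset (Fin n)} :
    A ∈ multipleKneserFamily P s k ↔
      A ⊆ Finset.univ.biUnion P ∧ A.card = k ∧ ∀ i, (A ∩ P i).card ≤ s i := by
  simp [multipleKneserFamily]

theorem card_eq_sum_inter (hdisj : ∀ i j, i ≠ j → Disjoint (P i) (P j))
    (huniv : Finset.univ.biUnion P = Finset.univ) (X : Finset (Fin n)) :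
    X.card = ∑ i, (X ∩ P i).card := by
  rw [← Finset.card_biUnion, ← Finset.inter_biUnion, huniv, Finset.inter_univ]
  intro i _ j _ hij
  exact Finset.disjoint_of_subset_left Finset.inter_subset_right
    (Finset.disjoint_of_subset_right Finset.inter_subset_right (hdisj i j hij))

/-- Take as many elements of `X` from each block as its bound allows, then discard down to `k`. -/
theorem exists_mem_multipleKneserFamily (hdisj : ∀ i j, i ≠ j → Disjoint (P i) (P j))
    (huniv : Finset.univ.biUnion P = Finset.univ) {X : Finset (Fin n)}
    (hX : k ≤ ∑ i, min (X ∩ P i).card (s i)) : ∃ A ∈ multipleKneserFamily P s k, A ⊆ X := by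
  have : ∀ i, ∃ B ⊆ X ∩ P i, B.card = min (X ∩ P i).card (s i) := fun i =>
    Finset.exists_subset_card_eq (min_le_left _ _)
  choose B hB hBc using this
  have hcard : (Finset.univ.biUnion B).card = ∑ i, min (X ∩ P i).card (s i) := by
    rw [Finset.card_biUnion]
    · exact Finset.sum_congr rfl fun i _ => hBc i
    · intro i _ j _ hij
      exact Finset.disjoint_of_subset_left ((hB i).trans Finset.inter_subset_right)
        (Finset.disjoint_of_subset_right ((hB j).trans Finset.inter_subset_right) (hdisj i j hij))
  obtain ⟨A, hA, hAc⟩ := Finset.exists_subset_card_eq (hX.trans_eq hcard.symm)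
  refine ⟨A, mem_multipleKneserFamily.2 ⟨by simp [huniv], hAc, fun i => ?_⟩, fun a ha => ?_⟩
  · refine (Finset.card_le_card (t := B i) fun a ha => ?_).trans
      ((hBc i).trans_le (min_le_right _ _))
    rw [Finset.mem_inter] at ha
    obtain ⟨j, -, hj⟩ := Finset.mem_biUnion.1 (hA ha.1)
    have haj := (Finset.mem_inter.1 (hB j hj)).2
    by_cases hij : i = j
    · exact hij ▸ hj
    · exact absurd haj (Finset.disjoint_left.1 (hdisj i j hij) ha.2)
  · obtain ⟨j, -, hj⟩ := Finset.mem_biUnion.1 (hA ha)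
    exact (Finset.mem_inter.1 (hB j hj)).1

theorem sum_min_inter_lt (hdisj : ∀ i j, i ≠ j → Disjoint (P i) (P j))
    (huniv : Finset.univ.biUnion P = Finset.univ) {X : Finset (Fin n)}
    (hX : ∀ A ∈ multipleKneserFamily P s k, ¬ A ⊆ X) : ∑ i, min (X ∩ P i).card (s i) < k := by
  by_contra! hcon
  obtain ⟨A, hA, hAX⟩ := exists_mem_multipleKneserFamily hdisj huniv hcon
  exact hX A hA hAX

/-- The members of the family inside a small set are pairwise intersecting. -/
theorem not_disjoint_of_sum_min_lt (hdisj : ∀ i j, i ≠ j → Disjoint (P i) (P j))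
    (huniv : Finset.univ.biUnion P = Finset.univ) {Y A B : Finset (Fin n)}
    (hY : ∑ i, min (Y ∩ P i).card (2 * s i) < 2 * k) (hA : A ∈ multipleKneserFamily P s k)
    (hB : B ∈ multipleKneserFamily P s k) (hAY : A ⊆ Y) (hBY : B ⊆ Y) : ¬ Disjoint A B := by
  intro hAB
  obtain ⟨-, hAc, hA⟩ := mem_multipleKneserFamily.1 hA
  obtain ⟨-, hBc, hB⟩ := mem_multipleKneserFamily.1 hB
  refine not_le.2 hY ?_
  calc 2 * k = ∑ i, ((A ∩ P i).card + (B ∩ P i).card) := by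
        rw [Finset.sum_add_distrib, ← card_eq_sum_inter hdisj huniv,
          ← card_eq_sum_inter hdisj huniv]
        omega
    _ ≤ _ := by
        refine Finset.sum_le_sum fun i _ => le_min ?_ ?_
        · rw [← Finset.card_union_of_disjoint (Finset.disjoint_of_subset_left
            Finset.inter_subset_left (Finset.disjoint_of_subset_right Finset.inter_subset_left hAB)),
            ← Finset.union_inter_distrib_right]
          exact Finset.card_le_card (Finset.inter_subset_inter_right (Finset.union_subset hAY hBY))
        · have := hA i
          have := hB i
          omega

theorem sum_min_insert_le (hdisj : ∀ i j, i ≠ j → Disjoint (P i) (P j)) (Y : Finset (Fin n))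
    (y : Fin n) :
    ∑ i, min (insert y Y ∩ P i).card (2 * s i) ≤ ∑ i, min (Y ∩ P i).card (2 * s i) + 1 := by
  have hone : ∑ i, (if y ∈ P i then 1 else 0) ≤ 1 := by
    rw [← Finset.card_filter, Finset.card_le_one]
    intro i hi j hj
    by_contra hij
    exact Finset.disjoint_left.1 (hdisj i j hij) (Finset.mem_filter.1 hi).2
      (Finset.mem_filter.1 hj).2
  refine le_trans ?_ (Nat.add_le_add_left hone _)
  rw [← Finset.sum_add_distrib]
  refine Finset.sum_le_sum fun i _ => ?_
  by_cases hy : y ∈ P i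
  · rw [Finset.insert_inter_of_mem hy, if_pos hy]
    have := Finset.card_insert_le y (Y ∩ P i)
    omega
  · rw [Finset.insert_inter_of_notMem hy, if_neg hy, add_zero]

theorem colorable_one_of_sum_min_lt (hdisj : ∀ i j, i ≠ j → Disjoint (P i) (P j))
    (huniv : Finset.univ.biUnion P = Finset.univ)
    (h : ∑ i, min (Finset.univ ∩ P i).card (2 * s i) < 2 * k) :
    (kneserGraph (multipleKneserFamily P s k)).Colorable 1 :=
  ⟨SimpleGraph.Coloring.mk (fun _ => 0) fun {A B} hAB => absurd hAB.2
    (not_disjoint_of_sum_min_lt hdisj huniv h A.2 B.2 (Finset.subset_univ _)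
      (Finset.subset_univ _))⟩

/-- The colors are the elements outside `Y`. One of them, `y`, is reserved for the members inside
`insert y Y`, which pairwise intersect; the `+ 1` in the hypothesis pays for adding `y`. Every other
member is colored by one of its elements outside `insert y Y`. -/
theorem colorable_of_sum_min_lt (hdisj : ∀ i j, i ≠ j → Disjoint (P i) (P j))
    (huniv : Finset.univ.biUnion P = Finset.univ) {Y : Finset (Fin n)} (hne : Y ≠ Finset.univ)
    (hY : ∑ i, min (Y ∩ P i).card (2 * s i) + 1 < 2 * k) :
    (kneserGraph (multipleKneserFamily P s k)).Colorable (n - Y.card) := by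
  classical
  obtain ⟨y, hy⟩ : ∃ y, y ∉ Y := by
    by_contra! hcon
    exact hne (Finset.eq_univ_iff_forall.2 hcon)
  have hcol : ∀ A : Finset (Fin n), ∃ b : {b // b ∈ Yᶜ},
      (b : Fin n) ∈ A ∧ (b : Fin n) ≠ y ∨ (b : Fin n) = y ∧ A ⊆ insert y Y := by
    intro A
    by_cases hA : A ⊆ insert y Y
    · exact ⟨⟨y, by simpa⟩, Or.inr ⟨rfl, hA⟩⟩
    · obtain ⟨b, hbA, hb⟩ := Finset.not_subset.1 hA
      rw [Finset.mem_insert, not_or] at hb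
      exact ⟨⟨b, by simpa using hb.2⟩, Or.inl ⟨hbA, hb.1⟩⟩
  choose col hcol using hcol
  have hC : (kneserGraph (multipleKneserFamily P s k)).Coloring {b // b ∈ Yᶜ} := by
    refine SimpleGraph.Coloring.mk (fun A => col A.1) fun {A B} hAB heq => ?_
    have hA := hcol A.1
    have hB := hcol B.1
    rw [← heq] at hB
    rcases hA with ⟨hA, hA'⟩ | ⟨hA, hA'⟩ <;> rcases hB with ⟨hB, hB'⟩ | ⟨hB, hB'⟩
    · exact Finset.disjoint_left.1 hAB.2 hA hB
    · exact hA' hB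
    · exact hB' hA
    · exact not_disjoint_of_sum_min_lt hdisj huniv ((sum_min_insert_le hdisj Y y).trans_lt hY)
        A.2 B.2 hA' hB' hAB.2
  have := hC.colorable
  simpa [Finset.card_compl] using this

/-- `Y` is the support of a longest alternating subsequence. As `σ` keeps blocks together, each
block meets it in an interval, so its two signs occur `a` and `b` times with `|a - b| ≤ 1`. Then
`min (a + b) (2 s) = min a s + min b s`, and each sign contributes at most `k - 1` in total since
neither part contains a member. -/
theorem exists_sum_min_lt_of_altLength (hdisj : ∀ i j, i ≠ j → Disjoint (P i) (P j))
    (huniv : Finset.univ.biUnion P = Finset.univ) {blk : Fin n → Fin m}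
    (hblk : ∀ i, i ∈ P (blk i)) {σ : Equiv.Perm (Fin n)} (hσ : Monotone fun i => blk (σ i))
    {x : Fin n → SignType}
    (hx : ∀ A ∈ multipleKneserFamily P s k, ¬ A ⊆ signPart x 1 ∧ ¬ A ⊆ signPart x (-1)) :
    ∃ Y : Finset (Fin n), Y.card = altLength (fun i => x (σ i)) ∧
      ∑ i, min (Y ∩ P i).card (2 * s i) + 1 < 2 * k := by
  obtain ⟨f, hmono, h0, hne⟩ := exists_isAlternating_altLength fun i => x (σ i)
  generalize altLength (fun i => x (σ i)) = l at *
  have hmem : ∀ a i, a ∈ P i ↔ blk a = i := by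
    intro a i
    constructor
    · intro ha
      by_contra hcon
      exact Finset.disjoint_left.1 (hdisj _ _ hcon) (hblk a) ha
    · rintro rfl; exact hblk a
  have hinj : Function.Injective fun j => σ (f j) := σ.injective.comp hmono.injective
  set J : Fin m → Finset (Fin l) := fun i => Finset.univ.filter fun j => blk (σ (f j)) = i with hJ
  have hJc : ∀ i, ((J i : Finset (Fin l)) : Set (Fin l)).OrdConnected := by
    intro i
    refine ⟨fun a ha b hb c hc => ?_⟩
    simp only [hJ, Finset.coe_filter, Finset.mem_univ, true_and, Set.mem_ofPred_eq] at ha hb ⊢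
    refine le_antisymm ?_ ?_
    · rw [← hb]; exact hσ (hmono.monotone hc.2)
    · rw [← ha]; exact hσ (hmono.monotone hc.1)
  set Y : Finset (Fin n) := Finset.univ.image fun j => σ (f j) with hY
  have hsign : ∀ e i, ((J i).filter fun j => x (σ (f j)) = e).card =
      ((Y ∩ signPart x e) ∩ P i).card := by
    intro e i
    rw [← Finset.card_image_of_injective _ hinj]
    congr 1
    ext a
    simp only [hJ, hY, signPart, Finset.mem_image, Finset.mem_filter, Finset.mem_univ, true_and,
      Finset.mem_inter, hmem]
    constructor
    · rintro ⟨j, ⟨h1, h2⟩, rfl⟩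
      exact ⟨⟨⟨j, rfl⟩, h2⟩, h1⟩
    · rintro ⟨⟨⟨j, rfl⟩, h2⟩, h1⟩
      exact ⟨j, ⟨h1, h2⟩, rfl⟩
  have hsum : ∀ i, (Y ∩ P i).card =
      ((Y ∩ signPart x 1) ∩ P i).card + ((Y ∩ signPart x (-1)) ∩ P i).card := by
    intro i
    rw [← Finset.card_union_of_disjoint, ← Finset.union_inter_distrib_right,
      ← Finset.inter_union_distrib_left]
    · congr 2
      refine (Finset.inter_eq_left.2 fun a ha => ?_).symm
      obtain ⟨j, -, rfl⟩ := Finset.mem_image.1 ha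
      have : x (σ (f j)) ≠ 0 := h0 j
      simp only [signPart, Finset.mem_union, Finset.mem_filter, Finset.mem_univ, true_and]
      revert this
      generalize x (σ (f j)) = u
      revert u
      decide
    · exact Finset.disjoint_of_subset_left
        (Finset.inter_subset_left.trans Finset.inter_subset_right)
        (Finset.disjoint_of_subset_right
          (Finset.inter_subset_left.trans Finset.inter_subset_right)
          (disjoint_signPart x (by decide)))
  refine ⟨Y, by rw [hY, Finset.card_image_of_injective _ hinj]; simp, ?_⟩
  have hp := sum_min_inter_lt (X := Y ∩ signPart x 1) hdisj huniv
    fun A hA hAX => (hx A hA).1 (hAX.trans Finset.inter_subset_right)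
  have hm := sum_min_inter_lt (X := Y ∩ signPart x (-1)) hdisj huniv
    fun A hA hAX => (hx A hA).2 (hAX.trans Finset.inter_subset_right)
  have : ∑ i, min (Y ∩ P i).card (2 * s i) =
      ∑ i, min ((Y ∩ signPart x 1) ∩ P i).card (s i) +
        ∑ i, min ((Y ∩ signPart x (-1)) ∩ P i).card (s i) := by
    rw [← Finset.sum_add_distrib]
    refine Finset.sum_congr rfl fun i _ => ?_
    have h1 := card_filter_le_of_alternating h0 hne (hJc i) 1
    have h2 := card_filter_le_of_alternating h0 hne (hJc i) (-1)
    rw [neg_neg, hsign, hsign] at h2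
    rw [hsign, hsign] at h1
    have := hsum i
    omega
  omega

theorem exists_sum_min_lt_of_altPerm (hk : 1 ≤ k) (hdisj : ∀ i j, i ≠ j → Disjoint (P i) (P j))
    (huniv : Finset.univ.biUnion P = Finset.univ) :
    ∃ (σ : Equiv.Perm (Fin n)) (Y : Finset (Fin n)),
      Y.card = altPerm (multipleKneserFamily P s k) σ ∧
      ∑ i, min (Y ∩ P i).card (2 * s i) + 1 < 2 * k := by
  have : ∀ a : Fin n, ∃ i, a ∈ P i := by
    intro a
    have ha : a ∈ Finset.univ.biUnion P := huniv ▸ Finset.mem_univ a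
    simpa using ha
  choose blk hblk using this
  refine ⟨Tuple.sort blk, ?_⟩
  rcases Set.eq_empty_or_nonempty {l : ℕ | ∃ x : Fin n → SignType, x ≠ 0 ∧
    (∀ A ∈ multipleKneserFamily P s k, ¬ A ⊆ signPart x 1 ∧ ¬ A ⊆ signPart x (-1)) ∧
    altLength (fun i => x (Tuple.sort blk i)) = l} with h | h
  -- Without admissible sign vectors `altPerm` is 0; the empty set works because `k ≥ 1`.
  · refine ⟨∅, by rw [altPerm, h, Finset.card_empty, csSup_empty]; rfl, ?_⟩
    simp only [Finset.empty_inter, Finset.card_empty, Nat.zero_min, Finset.sum_const_zero]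
    omega
  · obtain ⟨x, -, hx, hlen⟩ := Nat.sSup_mem h ⟨n, by
      rintro _ ⟨x, -, -, rfl⟩
      exact altLength_le _⟩
    obtain ⟨Y, hYc, hY⟩ := exists_sum_min_lt_of_altLength hdisj huniv hblk
      (Tuple.monotone_sort blk) hx
    exact ⟨Y, hYc.trans hlen, hY⟩

end MultipleKneser

/-! ### The main theorem -/

theorem mainTheorem9 :
    (∀ (n : ℕ) (F : Finset (Finset (Fin n))) (t : ℕ),
      F.Nonempty → ∅ ∉ F →
      (kneserGraph F).chromaticNumber = (t : ℕ∞) →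
      (t : ℤ) = (n : ℤ) - (altNumber F : ℤ) →
      Even t →
      circularChromaticNumber (kneserGraph F) = (t : ℝ)) ∧
    (∀ (n m k : ℕ) (P : Fin m → Finset (Fin n)) (s : Fin m → ℕ) (t : ℕ),
      1 ≤ k →
      (∀ i j, i ≠ j → Disjoint (P i) (P j)) →
      Finset.univ.biUnion P = Finset.univ →
      (∀ i, 1 ≤ s i) →
      (∀ i, s i ≤ (P i).card) →
      k ≤ ∑ i, s i →
      (kneserGraph (multipleKneserFamily P s k)).chromaticNumber = (t : ℕ∞) →
      Even t →
      circularChromaticNumber (kneserGraph (multipleKneserFamily P s k)) = (t : ℝ)) := by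
  constructor
  · intro n F t hne hF hchi ht heven
    obtain ⟨σ, hσ⟩ := exists_altPerm_eq_altNumber F
    exact circularChromaticNumber_kneserGraph (σ := σ) hne hF
      (SimpleGraph.chromaticNumber_le_iff_colorable.1 hchi.le) (by omega) heven
  · intro n m k P s t hk hdisj huniv _ hsP hks hchi heven
    obtain ⟨A, hA, -⟩ : ∃ A ∈ multipleKneserFamily P s k, A ⊆ Finset.univ := by
      refine exists_mem_multipleKneserFamily hdisj huniv (hks.trans_eq ?_)
      exact Finset.sum_congr rfl fun i _ => by rw [Finset.univ_inter, min_eq_right (hsP i)]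
    have hF : ∅ ∉ multipleKneserFamily P s k := by
      intro h
      have := (mem_multipleKneserFamily.1 h).2.1
      rw [Finset.card_empty] at this
      omega
    have hcol : (kneserGraph (multipleKneserFamily P s k)).Colorable t :=
      SimpleGraph.chromaticNumber_le_iff_colorable.1 hchi.le
    have hle : ∀ {c : ℕ}, (kneserGraph (multipleKneserFamily P s k)).Colorable c → t ≤ c := by
      intro c hc
      have := hc.chromaticNumber_le
      rw [hchi] at this
      exact_mod_cast this
    obtain ⟨σ, Y, hYc, hY⟩ := exists_sum_min_lt_of_altPerm (s := s) hk hdisj huniv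
    have hYn : Y.card ≤ n := by simpa using Finset.card_le_univ Y
    refine circularChromaticNumber_kneserGraph (σ := σ) ⟨A, hA⟩ hF hcol ?_ heven
    rw [← hYc]
    -- If `Y` is everything, no element is left to reserve as a color; but then the graph has no
    -- edges, so `t ≤ 1`, against `t` being positive and even.
    by_cases hYu : Y = Finset.univ
    · have h1 := hle (colorable_one_of_sum_min_lt hdisj huniv (by rw [← hYu]; omega))
      have h2 : 0 < t := by
        obtain ⟨c⟩ := hcol
        exact (c ⟨A, hA⟩).pos
      obtain ⟨r, rfl⟩ := heven
      omega
    · have := hle (colorable_of_sum_min_lt hdisj huniv hYu hY)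
      omega
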